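/- Throughout, matrices are real. For a psd matrix $A\in\mathbb R^{N\times N}$ and $S\subseteq\{1,\dots,N\}$, the column Nyström approximation with column set $S$ is $\hat A_S=A(:,S)\,A(S,S)^\dagger A(S,:)$, where $\dagger$ is the Moore–Penrose pseudoinverse; $[\![A]\!]_r$ denotes the best rank-$r$ approximation of $A$ given by its $r$-truncated eigenvalue decomposition. $k$-DPP sampling chooses a random set $S$ of $k$ columns with $$\mathbb P\{S\}=\frac{\det A(S,S)}{\sum_{|S'|=k}\det A(S',S')},$$ which is defined when the denominator is nonzero (equivalently, $\operatorname{rank}A\ge k$). Theorem ($k$-DPP sampling). Fix an integer $r\ge 1$ and a real number $\varepsilon>0$. (a) For every $N$, every psd matrix $A\in\mathbb R^{N\times N}$ and every integer $k\ge r/\varepsilon+r-1$ for which the $k$-DPP distribution of $A$ is defined, a random set $S$ drawn from it gives an $(r,\varepsilon)$-approximation: $$\mathbb E\operatorname{tr}(A-\hat A_S)\le(1+\varepsilon)\operatorname{tr}(A-[\![A]\!]_r).$$ (b) There exist $N$ and a psd matrix $A\in\mathbb R^{N\times N}$ such that for every integer $k$ with $0\le k<r/\varepsilon+r-1$ the $k$-DPP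 distribution of $A$ is defined and, for $S$ drawn from it, $$\mathbb E\operatorname{tr}(A-\hat A_S)>(1+\varepsilon)\operatorname{tr}(A-[\![A]\!]_r).$$ (c) There exist $N$ and a psd matrix $A\in\mathbb R^{N\times N}$ such that for every integer $k$ with $0\le k<r/\varepsilon$ and every $S\subseteq\{1,\dots,N\}$ with $|S|=k$, $$\operatorname{tr}(A-\hat A_S)>(1+\varepsilon)\operatorname{tr}(A-[\![A]\!]_r).$$ -/

import Mathlib

open Matrix

noncomputable section

namespace Nystrom

/-- The four Penrose equations: `X` is the Moore-Penrose pseudoinverse of the real matrix `M`. -/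
structure IsMoorePenrose {n : Type*} [Fintype n] (M X : Matrix n n ℝ) : Prop where
  mul_mul_left : M * X * M = M
  mul_mul_right : X * M * X = X
  left_symm : (M * X)ᵀ = M * X
  right_symm : (X * M)ᵀ = X * M

theorem IsMoorePenrose.unique {n : Type*} [Fintype n] {M X Y : Matrix n n ℝ}
    (hX : IsMoorePenrose M X) (hY : IsMoorePenrose M Y) : X = Y := by
  have h1 : M * X = M * Y := by
    calc M * X = (M * Y * M) * X := by rw [hY.mul_mul_left]
      _ = (M * Y)ᵀ * (M * X)ᵀ := by rw [hX.left_symm, hY.left_symm, ← Matrix.mul_assoc]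
      _ = (M * X * M * Y)ᵀ := by
        rw [← Matrix.transpose_mul, ← Matrix.mul_assoc]
      _ = M * Y := by rw [hX.mul_mul_left, hY.left_symm]
  have h2 : X * M = Y * M := by
    calc X * M = X * (M * Y * M) := by rw [hY.mul_mul_left]
      _ = (X * M)ᵀ * (Y * M)ᵀ := by
        rw [hX.right_symm, hY.right_symm]; simp only [Matrix.mul_assoc]
      _ = (Y * (M * X * M))ᵀ := by
        rw [← Matrix.transpose_mul]; simp only [Matrix.mul_assoc]
      _ = Y * M := by rw [hX.mul_mul_left, hY.right_symm]
  calc X = X * M * X := hX.mul_mul_right.symm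
    _ = Y * (M * X) := by rw [h2, Matrix.mul_assoc]
    _ = Y * M * Y := by rw [h1, ← Matrix.mul_assoc]
    _ = Y := hY.mul_mul_right

/-- Every real symmetric matrix has a Moore-Penrose pseudoinverse. -/
theorem exists_isMoorePenrose {n : Type*} [Fintype n] [DecidableEq n] {M : Matrix n n ℝ}
    (hM : M.IsHermitian) : ∃ X, IsMoorePenrose M X := by
  obtain ⟨U, d, hU, hMd⟩ : ∃ (U : Matrix n n ℝ) (d : n → ℝ), Uᵀ * U = 1 ∧
      M = U * diagonal d * Uᵀ := by
    refine ⟨hM.eigenvectorUnitary, hM.eigenvalues, ?_, ?_⟩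
    · have := Unitary.coe_star_mul_self hM.eigenvectorUnitary
      simpa [Matrix.star_eq_conjTranspose] using this
    · have := hM.spectral_theorem
      rw [Unitary.conjStarAlgAut_apply] at this
      simpa [Matrix.star_eq_conjTranspose, Function.comp_def] using this
  have key : ∀ a b : n → ℝ, (U * diagonal a * Uᵀ) * (U * diagonal b * Uᵀ)
      = U * diagonal (fun i => a i * b i) * Uᵀ := by
    intro a b
    calc _ = U * diagonal a * (Uᵀ * U) * diagonal b * Uᵀ := by simp only [Matrix.mul_assoc]
      _ = _ := by rw [hU, Matrix.mul_one, Matrix.mul_assoc U, Matrix.diagonal_mul_diagonal]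
  have symm : ∀ a : n → ℝ, (U * diagonal a * Uᵀ)ᵀ = U * diagonal a * Uᵀ := by
    intro a
    simp [Matrix.transpose_mul, Matrix.mul_assoc]
  subst hMd
  refine ⟨U * diagonal (fun i => (d i)⁻¹) * Uᵀ, ?_, ?_, ?_, ?_⟩
  · rw [key, key]; congr 3; ext i; exact mul_inv_mul_cancel (d i)
  · rw [key, key]; congr 3; ext i
    simpa using mul_inv_mul_cancel (d i)⁻¹
  · rw [key]; exact symm _
  · rw [key]; exact symm _

open Classical in
/-- The Moore-Penrose pseudoinverse. -/
def pinv {n : Type*} [Fintype n] (M : Matrix n n ℝ) : Matrix n n ℝ :=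
  if h : ∃ X, IsMoorePenrose M X then h.choose else 0

/-- On symmetric matrices, the only ones to which it is applied below, `pinv` is the
pseudoinverse. -/
theorem isMoorePenrose_pinv {n : Type*} [Fintype n] [DecidableEq n] {M : Matrix n n ℝ}
    (hM : M.IsHermitian) : IsMoorePenrose M (pinv M) := by
  have h := exists_isMoorePenrose hM
  rw [pinv, dif_pos h]
  exact h.choose_spec

variable {N : ℕ}

/-- The principal submatrix `A(S, S)`. -/
def principal (A : Matrix (Fin N) (Fin N) ℝ) (S : Finset (Fin N)) : Matrix S S ℝ :=
  A.submatrix (fun i : S => (i : Fin N)) (fun j : S => (j : Fin N))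

/-- The column Nyström approximation `A(:, S) A(S, S)† A(S, :)` with pivot set `S`. -/
def nystrom (A : Matrix (Fin N) (Fin N) ℝ) (S : Finset (Fin N)) : Matrix (Fin N) (Fin N) ℝ :=
  A.submatrix id (fun j : S => (j : Fin N)) * pinv (principal A S) *
    A.submatrix (fun i : S => (i : Fin N)) id

/-- The `r`-truncated eigenvalue decomposition of a symmetric matrix. Mathlib's decreasingly
ordered eigenvalues are indexed by `Fin (Fintype.card (Fin N))`, and the equivalence in the
condition gives the position in that order of the eigenvalue `hA.eigenvalues i`. -/
def lowRank {A : Matrix (Fin N) (Fin N) ℝ} (hA : A.IsHermitian) (r : ℕ) :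
    Matrix (Fin N) (Fin N) ℝ :=
  (hA.eigenvectorUnitary : Matrix (Fin N) (Fin N) ℝ) *
    diagonal (fun i : Fin N =>
      if ((Fintype.equivOfCardEq (Fintype.card_fin (Fintype.card (Fin N))) :
          Fin (Fintype.card (Fin N)) ≃ Fin N).symm i : ℕ) < r
        then hA.eigenvalues i else 0) *
    (hA.eigenvectorUnitary : Matrix (Fin N) (Fin N) ℝ)ᵀ

/-- The normalizing constant of `k`-DPP sampling: the sum of all `k × k` principal minors. -/
def dppNormalizer (A : Matrix (Fin N) (Fin N) ℝ) (k : ℕ) : ℝ :=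
  ∑ S ∈ (Finset.univ : Finset (Fin N)).powersetCard k, (principal A S).det

theorem det_principal_nonneg {A : Matrix (Fin N) (Fin N) ℝ} (hA : A.PosSemidef)
    (S : Finset (Fin N)) : 0 ≤ (principal A S).det :=
  (hA.submatrix _).det_nonneg

/-- The probability of the pivot set `S` under `k`-DPP sampling. -/
def dppWeight (A : Matrix (Fin N) (Fin N) ℝ) (k : ℕ) (S : Finset (Fin N)) : ℝ :=
  if S.card = k then (principal A S).det / dppNormalizer A k else 0

theorem dppWeight_nonneg {A : Matrix (Fin N) (Fin N) ℝ} (hA : A.PosSemidef) (k : ℕ)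
    (S : Finset (Fin N)) : 0 ≤ dppWeight A k S := by
  unfold dppWeight
  split_ifs
  · exact div_nonneg (det_principal_nonneg hA S)
      (Finset.sum_nonneg fun T _ => det_principal_nonneg hA T)
  · exact le_rfl

theorem sum_dppWeight {A : Matrix (Fin N) (Fin N) ℝ} {k : ℕ} (hk : dppNormalizer A k ≠ 0) :
    ∑ S : Finset (Fin N), dppWeight A k S = 1 := by
  have h : (Finset.univ : Finset (Finset (Fin N))).filter (fun S => S.card = k)
      = (Finset.univ : Finset (Fin N)).powersetCard k := by
    ext S; simp [Finset.mem_powersetCard]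
  simp only [dppWeight]
  rw [← Finset.sum_filter, h, ← Finset.sum_div]
  exact div_self hk

/-- The `k`-DPP law of the random pivot set of a psd matrix `A`: a set `S` of cardinality `k` has
probability `det A(S, S) / ∑ det A(S', S')`. It is defined when the normalizer does not vanish. -/
def kDPP {A : Matrix (Fin N) (Fin N) ℝ} (hA : A.PosSemidef) (k : ℕ)
    (hk : dppNormalizer A k ≠ 0) : PMF (Finset (Fin N)) :=
  PMF.ofFintype (fun S => ENNReal.ofReal (dppWeight A k S)) (by
    rw [← ENNReal.ofReal_sum_of_nonneg fun S _ => dppWeight_nonneg hA k S, sum_dppWeight hk,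
      ENNReal.ofReal_one])

/-- The expected trace-norm error `E tr(A - Â)` of the column Nyström approximation whose pivot
set is drawn from the law `p`. -/
def expectedError (A : Matrix (Fin N) (Fin N) ℝ) (p : PMF (Finset (Fin N))) : ℝ :=
  ∑ S : Finset (Fin N), (p S).toReal * (A - nystrom A S).trace

/-- The randomized Nyström approximation of `A` with pivot law `p` is an
`(r, ε)`-approximation. -/
def IsApproximation {A : Matrix (Fin N) (Fin N) ℝ} (hA : A.PosSemidef) (r : ℕ) (ε : ℝ)
    (p : PMF (Finset (Fin N))) : Prop :=
  expectedError A p ≤ (1 + ε) * (A - lowRank hA.isHermitian r).trace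

end Nystrom

end

/-! Everything rests on the ratio `(k + 1) e_{k+1} / e_k` of elementary symmetric polynomials of the
eigenvalues. The diagonal entry of `A - nystrom A S` at `i ∉ S` is a Schur complement, so
multiplying by `det A(S,S)` gives `det A(S ∪ {i}, S ∪ {i})` (`det_mul_trace_sub_nystrom`). Summing
over `S` counts every minor of size `k + 1` exactly `k + 1` times, and sums of principal minors are
the `e_k` (`dppNormalizer_eq_elemSymm_eigenvalues`). Hence the expected error is at most that ratio,
with equality when no minor vanishes.

Upper bound: if all but `r` eigenvalues sum to `τ`, every set of `k + 1` indices meets the tail at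
least `k + 1 - r` times, so `(k + 1 - r) e_{k+1} ≤ τ e_k` (`sub_mul_elemSymm_succ_le`). The factor
`(k + 1) / (k + 1 - r)` is at most `1 + ε` exactly when `k + 1 - r ≥ r / ε`.

Sharpness for k-DPP: a diagonal matrix with `r` entries `n` and `n` entries `1 / n` nearly attains
this factor for `k ≥ r`, while for `k < r` some large entry is always missed
(`mul_elemSymm_le_of_le_succ`, `mul_elemSymm_le_of_card_lt`).

Arbitrary columns: take `r` blocks `11ᵀ + δ I` of size `m`, with `δ = 1 / m`. An unselected column
in a block with `s` selected ones has error at least `δ + δ / (s + δ)`; by Cauchy–Schwarz an even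
split of the `k` columns is best. The resulting bound tends to `r (1 + r / k)` for `k > 0`, against
an optimum of at most `r`. -/

noncomputable section

namespace Nystrom

/-! ### Subset sums and inequalities for elementary symmetric polynomials. -/

/-- Adjoining an element to a `k`-subset, or deleting one from a `(k + 1)`-subset, enumerates the
same pairs. -/
theorem sum_powersetCard_insert {ι M : Type*} [Fintype ι] [DecidableEq ι] [AddCommMonoid M]
    (k : ℕ) (g : ι → Finset ι → M) :
    ∑ S ∈ (Finset.univ : Finset ι).powersetCard k, ∑ i ∈ Sᶜ, g i (insert i S) =
      ∑ T ∈ (Finset.univ : Finset ι).powersetCard (k + 1), ∑ i ∈ T, g i T := by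
  rw [Finset.sum_sigma', Finset.sum_sigma']
  refine Finset.sum_bij' (fun p _ => ⟨insert p.2 p.1, p.2⟩) (fun p _ => ⟨p.1.erase p.2, p.2⟩)
    ?_ ?_ ?_ ?_ ?_
  · rintro ⟨S, i⟩ h
    simp only [Finset.mem_sigma, Finset.mem_powersetCard_univ, Finset.mem_compl] at h ⊢
    exact ⟨by rw [Finset.card_insert_of_notMem h.2, h.1], Finset.mem_insert_self _ _⟩
  · rintro ⟨T, i⟩ h
    simp only [Finset.mem_sigma, Finset.mem_powersetCard_univ, Finset.mem_compl] at h ⊢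
    exact ⟨by rw [Finset.card_erase_of_mem h.2, h.1, Nat.add_sub_cancel],
      Finset.notMem_erase _ _⟩
  · rintro ⟨S, i⟩ h
    simp only [Finset.mem_sigma, Finset.mem_compl] at h
    simp [Finset.erase_insert h.2]
  · rintro ⟨T, i⟩ h
    simp only [Finset.mem_sigma] at h
    simp [Finset.insert_erase h.2]
  · rintro ⟨S, i⟩ _
    rfl

/-- The elementary symmetric polynomial of degree `k` in the values of `d`. -/
def elemSymm {ι : Type*} [Fintype ι] (d : ι → ℝ) (k : ℕ) : ℝ :=
  ∑ S ∈ (Finset.univ : Finset ι).powersetCard k, ∏ i ∈ S, d i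

section elemSymm

variable {ι : Type*} [Fintype ι] {d : ι → ℝ}

theorem elemSymm_nonneg (hd : ∀ i, 0 ≤ d i) (k : ℕ) : 0 ≤ elemSymm d k :=
  Finset.sum_nonneg fun _ _ => Finset.prod_nonneg fun i _ => hd i

theorem elemSymm_pos (hd : ∀ i, 0 < d i) {k : ℕ} (hk : k ≤ Fintype.card ι) :
    0 < elemSymm d k :=
  Finset.sum_pos (fun _ _ => Finset.prod_pos fun i _ => hd i)
    (Finset.powersetCard_nonempty.2 (by simpa using hk))

variable [DecidableEq ι]

/-- Weighting each `(k + 1)`-subset by the number of its elements in `C`. -/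
theorem sum_card_inter_mul_prod (d : ι → ℝ) (C : Finset ι) (k : ℕ) :
    ∑ T ∈ (Finset.univ : Finset ι).powersetCard (k + 1), ((T ∩ C).card : ℝ) * ∏ i ∈ T, d i =
      ∑ S ∈ (Finset.univ : Finset ι).powersetCard k, (∑ i ∈ C \ S, d i) * ∏ i ∈ S, d i := by
  have h := sum_powersetCard_insert k
    (fun i T : _ => if i ∈ C then ∏ j ∈ T, d j else (0 : ℝ))
  refine Eq.trans (Finset.sum_congr rfl fun T _ => ?_) (h.symm.trans
    (Finset.sum_congr rfl fun S _ => ?_))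
  · rw [← Finset.sum_filter, Finset.sum_const, nsmul_eq_mul, Finset.filter_mem_eq_inter]
  · rw [← Finset.sum_filter, Finset.sum_mul]
    have : Sᶜ.filter (· ∈ C) = C \ S := by ext; simp [and_comm]
    rw [this]
    exact Finset.sum_congr rfl fun i hi =>
      Finset.prod_insert (Finset.mem_sdiff.1 hi).2

theorem succ_mul_elemSymm (d : ι → ℝ) (k : ℕ) :
    ((k : ℝ) + 1) * elemSymm d (k + 1) =
      ∑ S ∈ (Finset.univ : Finset ι).powersetCard k, (∑ i ∈ Sᶜ, d i) * ∏ i ∈ S, d i := by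
  have h := sum_card_inter_mul_prod d Finset.univ k
  simp only [Finset.inter_univ, ← Finset.compl_eq_univ_sdiff] at h
  rw [← h, elemSymm, Finset.mul_sum]
  refine Finset.sum_congr rfl fun T hT => ?_
  rw [(Finset.mem_powersetCard.1 hT).2, Nat.cast_succ]

/-- If all but at most `r` of the values sum to `τ`, then `e_{k+1} / e_k ≤ τ / (k + 1 - r)`. -/
theorem sub_mul_elemSymm_succ_le (hd : ∀ i, 0 ≤ d i) (C : Finset ι) {r : ℕ} (hC : Cᶜ.card ≤ r)
    (k : ℕ) :
    ((k : ℝ) + 1 - r) * elemSymm d (k + 1) ≤ (∑ i ∈ C, d i) * elemSymm d k := by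
  calc ((k : ℝ) + 1 - r) * elemSymm d (k + 1)
      ≤ ∑ T ∈ (Finset.univ : Finset ι).powersetCard (k + 1),
          ((T ∩ C).card : ℝ) * ∏ i ∈ T, d i := by
        rw [elemSymm, Finset.mul_sum]
        refine Finset.sum_le_sum fun T hT => mul_le_mul_of_nonneg_right ?_
          (Finset.prod_nonneg fun i _ => hd i)
        -- At most `r` elements of `T` lie outside `C`.
        have h1 : T.card ≤ (T ∩ C).card + r := by
          rw [← Finset.card_inter_add_card_sdiff T C]
          gcongr
          refine (Finset.card_le_card fun x hx => ?_).trans hC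
          simpa using (Finset.mem_sdiff.1 hx).2
        rw [(Finset.mem_powersetCard.1 hT).2] at h1
        have : ((k : ℝ) + 1) ≤ (T ∩ C).card + r := by exact_mod_cast h1
        linarith
    _ ≤ _ := by
        rw [sum_card_inter_mul_prod, elemSymm, Finset.mul_sum]
        refine Finset.sum_le_sum fun S _ => mul_le_mul_of_nonneg_right ?_
          (Finset.prod_nonneg fun i _ => hd i)
        exact Finset.sum_le_sum_of_subset_of_nonneg Finset.sdiff_subset fun i _ _ => hd i

/-- If more than `k` values are at least `t`, then `e_{k+1} / e_k ≥ t / (k + 1)`. -/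
theorem mul_elemSymm_le_of_card_lt (hd : ∀ i, 0 ≤ d i) {B : Finset ι} {t : ℝ}
    (hB : ∀ i ∈ B, t ≤ d i) {k : ℕ} (hk : k < B.card) :
    t * elemSymm d k ≤ ((k : ℝ) + 1) * elemSymm d (k + 1) := by
  rw [succ_mul_elemSymm, elemSymm, Finset.mul_sum]
  refine Finset.sum_le_sum fun S hS => mul_le_mul_of_nonneg_right ?_
    (Finset.prod_nonneg fun i _ => hd i)
  -- A set of `k` indices cannot exhaust `B`, so one value at least `t` remains to be adjoined.
  obtain ⟨b, hb, hbS⟩ := Finset.exists_mem_notMem_of_card_lt_card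
    ((Finset.mem_powersetCard.1 hS).2.trans_lt hk)
  exact (hB b hb).trans (Finset.single_le_sum (fun i _ => hd i) (Finset.mem_compl.2 hbS))

/-- A lower bound for `e_{k+1} / e_k` when `r` values equal `t` and the others are equal and have
sum one. -/
theorem mul_elemSymm_le_of_le_succ {B : Finset ι} {r k : ℕ} {t u : ℝ} (ht : 0 < t) (hu : 0 ≤ u)
    (hBt : ∀ i ∈ B, d i = t) (hBu : ∀ i, i ∉ B → d i = u) (hB : B.card = r)
    (hsum : (Bᶜ.card : ℝ) * u = 1) (hk : r ≤ k + 1) :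
    (1 - k * u) * elemSymm d k ≤ ((k : ℝ) + 1 - r + r / t) * elemSymm d (k + 1) := by
  have hd : ∀ i, 0 ≤ d i := fun i => by
    by_cases h : i ∈ B
    · rw [hBt i h]; exact ht.le
    · rw [hBu i h]; exact hu
  have hprod : ∀ S : Finset ι, 0 ≤ ∏ i ∈ S, d i := fun S => Finset.prod_nonneg fun i _ => hd i
  -- A `k`-subset removes at most `k` of the small values, which leaves a sum of at least `1 - k *
  -- u`.
  have h1 : (1 - k * u) * elemSymm d k ≤
      ∑ T ∈ (Finset.univ : Finset ι).powersetCard (k + 1),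
        ((T ∩ Bᶜ).card : ℝ) * ∏ i ∈ T, d i := by
    rw [sum_card_inter_mul_prod, elemSymm, Finset.mul_sum]
    refine Finset.sum_le_sum fun S hS => mul_le_mul_of_nonneg_right ?_ (hprod S)
    rw [Finset.sum_congr rfl fun i hi => hBu i (Finset.mem_compl.1 (Finset.mem_sdiff.1 hi).1),
      Finset.sum_const, nsmul_eq_mul, ← hsum, ← sub_mul]
    refine mul_le_mul_of_nonneg_right ?_ hu
    have := Finset.le_card_sdiff S Bᶜ
    rw [(Finset.mem_powersetCard.1 hS).2, tsub_le_iff_right] at this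
    have : (Bᶜ.card : ℝ) ≤ (Bᶜ \ S).card + k := by exact_mod_cast this
    linarith
  -- Since `|T ∩ Bᶜ| = k + 1 - r + |B \ T|`, it remains to control how many large values `T` misses.
  -- Adjoining a missed one gains a factor `t`, so the total is at most `(r / t) e_{k+2}`.
  have h2 : ∑ T ∈ (Finset.univ : Finset ι).powersetCard (k + 1),
        ((B \ T).card : ℝ) * ∏ i ∈ T, d i ≤ r / t * elemSymm d (k + 1) := by
    have h3 : t * ∑ T ∈ (Finset.univ : Finset ι).powersetCard (k + 1),
        ((B \ T).card : ℝ) * ∏ i ∈ T, d i ≤ r * elemSymm d (k + 2) := by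
      have h4 := sum_card_inter_mul_prod d B (k + 1)
      calc _ = ∑ S ∈ (Finset.univ : Finset ι).powersetCard (k + 1),
              (∑ i ∈ B \ S, d i) * ∏ i ∈ S, d i := by
            rw [Finset.mul_sum]
            refine Finset.sum_congr rfl fun S _ => ?_
            rw [Finset.sum_congr rfl fun i hi => hBt i (Finset.mem_sdiff.1 hi).1,
              Finset.sum_const, nsmul_eq_mul]
            ring
        _ ≤ _ := by
            rw [← h4, elemSymm, Finset.mul_sum]
            refine Finset.sum_le_sum fun T _ => mul_le_mul_of_nonneg_right ?_ (hprod T)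
            rw [← hB]
            exact_mod_cast Finset.card_le_card Finset.inter_subset_right
    -- The upper bound at `k + 1`, with tail sum one and `k + 2 - r ≥ 1`.
    have h5 : elemSymm d (k + 2) ≤ elemSymm d (k + 1) := by
      have h6 := sub_mul_elemSymm_succ_le hd Bᶜ (by rw [compl_compl, hB]) (k + 1)
      rw [Finset.sum_congr rfl fun i hi => hBu i (Finset.mem_compl.1 hi), Finset.sum_const,
        nsmul_eq_mul, hsum, one_mul] at h6
      refine le_trans (le_mul_of_one_le_left (elemSymm_nonneg hd _) ?_) h6
      have : (r : ℝ) ≤ k + 1 := by exact_mod_cast hk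
      push_cast
      linarith
    rw [div_mul_eq_mul_div, le_div_iff₀ ht, mul_comm]
    exact h3.trans (mul_le_mul_of_nonneg_left h5 (Nat.cast_nonneg _))
  refine h1.trans ?_
  rw [add_mul]
  refine le_trans (le_of_eq ?_) (add_le_add_right h2 _)
  rw [elemSymm, Finset.mul_sum, ← Finset.sum_add_distrib]
  refine Finset.sum_congr rfl fun T hT => ?_
  rw [← add_mul]
  congr 1
  have e1 := Finset.card_inter_add_card_sdiff T B
  have e2 := Finset.card_inter_add_card_sdiff B T
  rw [(Finset.mem_powersetCard.1 hT).2] at e1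
  rw [hB, Finset.inter_comm] at e2
  rw [← Finset.sdiff_eq_inter_compl]
  have e1' : ((T ∩ B).card : ℝ) + (T \ B).card = k + 1 := by exact_mod_cast e1
  have e2' : ((T ∩ B).card : ℝ) + (B \ T).card = r := by exact_mod_cast e2
  linarith

end elemSymm

/-! ### Normalizers as elementary symmetric polynomials. -/

theorem dppNormalizer_eq_elemSymm_eigenvalues {N : ℕ} {A : Matrix (Fin N) (Fin N) ℝ}
    (hA : A.IsHermitian) (k : ℕ) : dppNormalizer A k = elemSymm hA.eigenvalues k := by
  by_cases hk : k ≤ N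
  · have hk' : k ≤ Fintype.card (Fin N) := by simpa using hk
    -- The coefficient of `X ^ (N - k)` in the characteristic polynomial, read once from the minors
    -- and once from the roots; both carry the sign `(-1) ^ k`.
    have h1 := charpoly_coeff_eq_sum_minors A k hk'
    rw [hA.charpoly_eq] at h1
    have h2 := Multiset.prod_X_sub_C_coeff (Finset.univ.val.map hA.eigenvalues)
      (k := Fintype.card (Fin N) - k) (by simp)
    rw [Multiset.map_map] at h2
    have h3 : Multiset.card (Finset.univ.val.map hA.eigenvalues)
        - (Fintype.card (Fin N) - k) = k := by
      simp; omega
    rw [h3, Finset.esymm_map_val] at h2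
    have h4 := h2.symm.trans h1
    exact (mul_left_cancel₀ (pow_ne_zero _ (by norm_num)) h4).symm
  · have : (Finset.univ : Finset (Fin N)).powersetCard k = ∅ :=
      Finset.powersetCard_eq_empty.2 (by simpa using hk)
    simp [dppNormalizer, elemSymm, this]

theorem det_principal_diagonal {N : ℕ} (d : Fin N → ℝ) (S : Finset (Fin N)) :
    (principal (diagonal d) S).det = ∏ i ∈ S, d i := by
  rw [principal, submatrix_diagonal _ _ Subtype.val_injective, det_diagonal]
  exact Finset.prod_coe_sort S d

theorem dppNormalizer_diagonal {N : ℕ} (d : Fin N → ℝ) (k : ℕ) :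
    dppNormalizer (diagonal d) k = elemSymm d k :=
  Finset.sum_congr rfl fun S _ => det_principal_diagonal d S

/-! ### The eigenvalue tail left by truncation. -/

theorem eq_eigenvectorUnitary_mul {N : ℕ} {A : Matrix (Fin N) (Fin N) ℝ} (hA : A.IsHermitian) :
    A = (hA.eigenvectorUnitary : Matrix (Fin N) (Fin N) ℝ) * diagonal hA.eigenvalues *
      (hA.eigenvectorUnitary : Matrix (Fin N) (Fin N) ℝ)ᵀ := by
  have := hA.spectral_theorem
  rw [Unitary.conjStarAlgAut_apply] at this
  simpa [Matrix.star_eq_conjTranspose, Function.comp_def] using this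

theorem transpose_mul_eigenvectorUnitary {N : ℕ} {A : Matrix (Fin N) (Fin N) ℝ}
    (hA : A.IsHermitian) :
    (hA.eigenvectorUnitary : Matrix (Fin N) (Fin N) ℝ)ᵀ *
      (hA.eigenvectorUnitary : Matrix (Fin N) (Fin N) ℝ) = 1 := by
  have := Unitary.coe_star_mul_self hA.eigenvectorUnitary
  simpa [Matrix.star_eq_conjTranspose] using this

/-- The indices outside the `r` largest eigenvalues. -/
def tailIndices (N r : ℕ) : Finset (Fin N) :=
  Finset.univ.filter fun i => r ≤ ((Fintype.equivOfCardEq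
    (Fintype.card_fin (Fintype.card (Fin N))) :
      Fin (Fintype.card (Fin N)) ≃ Fin N).symm i : ℕ)

theorem trace_sub_lowRank {N : ℕ} {A : Matrix (Fin N) (Fin N) ℝ} (hA : A.IsHermitian) (r : ℕ) :
    (A - lowRank hA r).trace = ∑ i ∈ tailIndices N r, hA.eigenvalues i := by
  have key : ∀ a : Fin N → ℝ, ((hA.eigenvectorUnitary : Matrix (Fin N) (Fin N) ℝ) * diagonal a *
      (hA.eigenvectorUnitary : Matrix (Fin N) (Fin N) ℝ)ᵀ).trace = ∑ i, a i := by
    intro a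
    rw [trace_mul_comm, ← Matrix.mul_assoc, transpose_mul_eigenvectorUnitary, Matrix.one_mul,
      trace_diagonal]
  have hA' : A.trace = ∑ i, hA.eigenvalues i := by
    conv_lhs => rw [eq_eigenvectorUnitary_mul hA]
    exact key _
  rw [trace_sub, hA', lowRank, key, ← Finset.sum_sub_distrib, tailIndices, Finset.sum_filter]
  refine Finset.sum_congr rfl fun i _ => ?_
  split_ifs with h1 h2 h2
  · omega
  · simp
  · simp
  · omega

theorem card_tailIndices_compl_le (N r : ℕ) : (tailIndices N r)ᶜ.card ≤ r := by
  rw [← Finset.card_range r]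
  refine Finset.card_le_card_of_injOn (fun i => ((Fintype.equivOfCardEq
    (Fintype.card_fin (Fintype.card (Fin N))) :
      Fin (Fintype.card (Fin N)) ≃ Fin N).symm i : ℕ)) (fun i hi => ?_) ?_
  · simpa [tailIndices] using hi
  · intro i _ j _ h
    exact Equiv.injective _ (Fin.ext h)

theorem card_tailIndices_le (N r : ℕ) : (tailIndices N r).card ≤ N - r := by
  rw [← Nat.card_Ico]
  refine Finset.card_le_card_of_injOn (fun i => ((Fintype.equivOfCardEq
    (Fintype.card_fin (Fintype.card (Fin N))) :
      Fin (Fintype.card (Fin N)) ≃ Fin N).symm i : ℕ)) (fun i hi => ?_) ?_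
  · have h1 : r ≤ _ := (Finset.mem_filter.1 hi).2
    simp only [Finset.coe_Ico, Set.mem_Ico]
    exact ⟨h1, by simpa using ((Fintype.equivOfCardEq
      (Fintype.card_fin (Fintype.card (Fin N))) :
      Fin (Fintype.card (Fin N)) ≃ Fin N).symm i).isLt⟩
  · intro i _ j _ h
    exact Equiv.injective _ (Fin.ext h)

theorem eigenvalues_le_of_mem_tailIndices {N : ℕ} {A : Matrix (Fin N) (Fin N) ℝ}
    (hA : A.IsHermitian) {r : ℕ} {c : ℝ} (hrank : (A - c • 1).rank ≤ r) {i : Fin N}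
    (hi : i ∈ tailIndices N r) : hA.eigenvalues i ≤ c := by
  by_contra! hc
  set e : Fin (Fintype.card (Fin N)) ≃ Fin N :=
    Fintype.equivOfCardEq (Fintype.card_fin (Fintype.card (Fin N))) with he
  have hi' : r ≤ (e.symm i : ℕ) := (Finset.mem_filter.1 hi).2
  have hcard : (A - c • 1).rank = Fintype.card {j // hA.eigenvalues j - c ≠ 0} := by
    have hU := transpose_mul_eigenvectorUnitary hA
    set U := (hA.eigenvectorUnitary : Matrix (Fin N) (Fin N) ℝ)
    have hU' : U * Uᵀ = 1 := mul_eq_one_comm.1 hU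
    have h1 : A - c • 1 = U * diagonal (fun j => hA.eigenvalues j - c) * Uᵀ := by
      have : diagonal (fun j => hA.eigenvalues j - c) =
          diagonal hA.eigenvalues - c • (1 : Matrix (Fin N) (Fin N) ℝ) := by
        rw [smul_one_eq_diagonal, diagonal_sub]
      rw [this, Matrix.mul_sub, Matrix.sub_mul, ← eq_eigenvectorUnitary_mul hA]
      simp [hU']
    have hdet : IsUnit U.det := (isUnit_iff_isUnit_det U).1 (IsUnit.of_mul_eq_one _ hU')
    rw [h1, rank_mul_eq_left_of_isUnit_det _ _ (by rwa [det_transpose]),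
      rank_mul_eq_right_of_isUnit_det _ _ hdet, rank_diagonal]
  -- Eigenvalues decrease with position, so an eigenvalue above `c` at position at least `r`,
  -- counted from zero, would give `A - c • 1` at least `r + 1` nonzero eigenvalues.
  have hlt : (Finset.Iic (e.symm i)).card ≤ Fintype.card {j // hA.eigenvalues j - c ≠ 0} := by
    rw [Fintype.card_subtype]
    refine Finset.card_le_card_of_injOn e (fun j hj => ?_) e.injective.injOn
    have h2 : hA.eigenvalues i ≤ hA.eigenvalues (e j) := by
      have := hA.eigenvalues₀_antitone (Finset.mem_Iic.1 hj)
      simpa [IsHermitian.eigenvalues, ← he] using this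
    simp only [Finset.coe_filter, Finset.mem_univ, true_and, Set.mem_ofPred_eq]
    linarith
  rw [Fin.card_Iic] at hlt
  omega

/-- A perturbation of `c` times the identity by a matrix of rank at most `r` has small tail. -/
theorem trace_sub_lowRank_le {N : ℕ} {A : Matrix (Fin N) (Fin N) ℝ}
    (hA : A.IsHermitian) {r : ℕ} {c : ℝ} (hc : 0 ≤ c) (hrank : (A - c • 1).rank ≤ r) :
    (A - lowRank hA r).trace ≤ ((N - r : ℕ) : ℝ) * c := by
  rw [trace_sub_lowRank]
  refine (Finset.sum_le_card_nsmul _ _ c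
    fun i hi => eigenvalues_le_of_mem_tailIndices hA hrank hi).trans ?_
  rw [nsmul_eq_mul]
  exact mul_le_mul_of_nonneg_right (by exact_mod_cast card_tailIndices_le N r) hc

/-! ### The Nyström residual as a congruence and as a Schur complement. -/

/-- The inclusion of the coordinates in `S`. -/
def inclusion {N : ℕ} (S : Finset (Fin N)) : Matrix (Fin N) S ℝ :=
  (1 : Matrix (Fin N) (Fin N) ℝ).submatrix id (fun j : S => (j : Fin N))

/-- The map taking a vector to its residual in the `A`-orthogonal projection onto the coordinates
in `S`. -/
def residualMap {N : ℕ} (A : Matrix (Fin N) (Fin N) ℝ) (S : Finset (Fin N)) :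
    Matrix (Fin N) (Fin N) ℝ :=
  1 - inclusion S * (pinv (principal A S) * ((inclusion S)ᵀ * A))

theorem residualMap_apply_of_notMem {N : ℕ} (A : Matrix (Fin N) (Fin N) ℝ)
    {S : Finset (Fin N)} {i : Fin N} (hi : i ∉ S) (j : Fin N) :
    residualMap A S i j = (1 : Matrix (Fin N) (Fin N) ℝ) i j := by
  have : ∀ x : S, inclusion S i x = 0 := fun x => by
    rw [inclusion, submatrix_apply, id, one_apply_ne]
    rintro rfl
    exact hi x.2
  rw [residualMap, Matrix.sub_apply, Matrix.mul_apply]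
  simp [this]

theorem mul_inclusion {N : ℕ} (A : Matrix (Fin N) (Fin N) ℝ) (S : Finset (Fin N)) :
    A * inclusion S = A.submatrix id (fun j : S => (j : Fin N)) := by
  ext i j
  simp [inclusion, Matrix.mul_apply, Matrix.one_apply]

theorem transpose_inclusion_mul {N : ℕ} (A : Matrix (Fin N) (Fin N) ℝ) (S : Finset (Fin N)) :
    (inclusion S)ᵀ * A = A.submatrix (fun j : S => (j : Fin N)) id := by
  ext i j
  simp [inclusion, Matrix.mul_apply, Matrix.one_apply]

theorem principal_eq {N : ℕ} (A : Matrix (Fin N) (Fin N) ℝ) (S : Finset (Fin N)) :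
    principal A S = (inclusion S)ᵀ * (A * inclusion S) := by
  rw [← Matrix.mul_assoc, transpose_inclusion_mul]
  ext i j
  simp [inclusion, principal, Matrix.mul_apply, Matrix.one_apply]

theorem nystrom_eq {N : ℕ} (A : Matrix (Fin N) (Fin N) ℝ) (S : Finset (Fin N)) :
    nystrom A S = A * (inclusion S * (pinv (principal A S) * ((inclusion S)ᵀ * A))) := by
  rw [nystrom, ← mul_inclusion, ← transpose_inclusion_mul]
  simp only [Matrix.mul_assoc]

/-- Expanding the congruence, `P M P = P` for the pseudoinverse `P` of `M = A(S,S)` collapses the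
quadratic term onto one linear term. No invertibility is needed, so this form serves for positivity
and for lower bounds over arbitrary `S`. -/
theorem sub_nystrom_eq_conj {N : ℕ} {A : Matrix (Fin N) (Fin N) ℝ} (hA : A.IsHermitian)
    (S : Finset (Fin N)) :
    A - nystrom A S = (residualMap A S)ᵀ * A * residualMap A S := by
  have hAt : Aᵀ = A := by simpa [IsHermitian] using hA
  have hMt : (principal A S)ᵀ = principal A S := by
    rw [principal, transpose_submatrix, hAt]
  have hP := isMoorePenrose_pinv (M := principal A S) (by simpa [IsHermitian] using hMt)
  -- The transpose satisfies the same Penrose equations, so uniqueness applies.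
  have hPt : (pinv (principal A S))ᵀ = pinv (principal A S) := by
    refine IsMoorePenrose.unique (M := principal A S) ⟨?_, ?_, ?_, ?_⟩ hP
    · have := congrArg transpose hP.mul_mul_left
      simpa [transpose_mul, hMt, Matrix.mul_assoc] using this
    · have := congrArg transpose hP.mul_mul_right
      simpa [transpose_mul, hMt, Matrix.mul_assoc] using this
    · have := hP.right_symm
      rw [transpose_mul, hMt] at this
      rw [this, transpose_mul, hMt, this]
    · have := hP.left_symm
      rw [transpose_mul, hMt] at this
      rw [this, transpose_mul, hMt, this]
  rw [nystrom_eq, residualMap]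
  have h2 := hP.mul_mul_right
  rw [principal_eq] at h2 hPt ⊢
  set J := inclusion S
  set P := pinv (Jᵀ * (A * J))
  have h3 : P * (Jᵀ * (A * (J * (P * (Jᵀ * A))))) = P * (Jᵀ * A) := by
    rw [← Matrix.mul_assoc P Jᵀ A]
    conv_rhs => rw [← h2]
    simp only [Matrix.mul_assoc]
  simp only [transpose_sub, transpose_one, transpose_mul, transpose_transpose, hPt, hAt,
    Matrix.sub_mul, Matrix.mul_sub, Matrix.one_mul, Matrix.mul_one, Matrix.mul_assoc, h3]
  abel

theorem posSemidef_sub_nystrom {N : ℕ} {A : Matrix (Fin N) (Fin N) ℝ} (hA : A.PosSemidef)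
    (S : Finset (Fin N)) : (A - nystrom A S).PosSemidef := by
  rw [sub_nystrom_eq_conj hA.isHermitian]
  simpa using hA.conjTranspose_mul_mul_same (residualMap A S)

theorem pinv_eq_inv {n : Type*} [Fintype n] [DecidableEq n] {M : Matrix n n ℝ}
    (hM : M.IsHermitian) (hdet : M.det ≠ 0) : pinv M = M⁻¹ := by
  have hu : IsUnit M.det := hdet.isUnit
  refine (isMoorePenrose_pinv hM).unique ⟨?_, ?_, ?_, ?_⟩
  · rw [mul_nonsing_inv _ hu, Matrix.one_mul]
  · rw [nonsing_inv_mul _ hu, Matrix.one_mul]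
  · rw [mul_nonsing_inv _ hu, transpose_one]
  · rw [nonsing_inv_mul _ hu, transpose_one]

theorem isHermitian_principal {N : ℕ} {A : Matrix (Fin N) (Fin N) ℝ} (hA : A.IsHermitian)
    (S : Finset (Fin N)) : (principal A S).IsHermitian :=
  hA.submatrix _

theorem sub_nystrom_apply_of_mem {N : ℕ} {A : Matrix (Fin N) (Fin N) ℝ} (hA : A.IsHermitian)
    {S : Finset (Fin N)} (hdet : (principal A S).det ≠ 0) {i : Fin N} (hi : i ∈ S) (j : Fin N) :
    (A - nystrom A S) i j = 0 := by
  have h : (inclusion S)ᵀ * (A - nystrom A S) = 0 := by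
    rw [Matrix.mul_sub, nystrom_eq, pinv_eq_inv (isHermitian_principal hA S) hdet]
    have : (inclusion S)ᵀ * (A * (inclusion S * ((principal A S)⁻¹ * ((inclusion S)ᵀ * A)))) =
        principal A S * (principal A S)⁻¹ * ((inclusion S)ᵀ * A) := by
      conv_rhs => enter [1, 1]; rw [principal_eq A S]
      simp only [Matrix.mul_assoc]
    rw [this, mul_nonsing_inv _ hdet.isUnit, Matrix.one_mul, sub_self]
  rw [transpose_inclusion_mul] at h
  exact congrFun (congrFun h ⟨i, hi⟩) j

/-- Ordering `insert i S` with `i` last, the residual entry is the Schur complement of `A(S,S)`, and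
the block determinant formula applies. -/
theorem det_mul_sub_nystrom_apply {N : ℕ} {A : Matrix (Fin N) (Fin N) ℝ} (hA : A.IsHermitian)
    {S : Finset (Fin N)} (hdet : (principal A S).det ≠ 0) {i : Fin N} (hi : i ∉ S) :
    (principal A S).det * (A - nystrom A S) i i = (principal A (insert i S)).det := by
  let e : S ⊕ Unit ≃ (insert i S : Finset (Fin N)) :=
    (Equiv.optionEquivSumPUnit S).symm.trans (Finset.subtypeInsertEquivOption hi).symm
  have hblocks : (principal A (insert i S)).submatrix e e =
      fromBlocks (principal A S) (A.submatrix (fun j : S => (j : Fin N)) fun _ : Unit => i)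
        (A.submatrix (fun _ : Unit => i) fun j : S => (j : Fin N))
        (A.submatrix (fun _ : Unit => i) fun _ : Unit => i) := by
    ext (a | a) (b | b) <;> rfl
  let := invertibleOfIsUnitDet _ hdet.isUnit
  rw [← det_submatrix_equiv_self e, hblocks, det_fromBlocks₁₁,
    det_unique (n := Unit), invOf_eq_nonsing_inv, ← pinv_eq_inv (isHermitian_principal hA S) hdet]
  rfl

/-- The error trace times the minor is the sum of the minors with one more index. -/
theorem det_mul_trace_sub_nystrom {N : ℕ} {A : Matrix (Fin N) (Fin N) ℝ} (hA : A.IsHermitian)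
    {S : Finset (Fin N)} (hdet : (principal A S).det ≠ 0) :
    (principal A S).det * (A - nystrom A S).trace =
      ∑ i ∈ Sᶜ, (principal A (insert i S)).det := by
  simp only [Matrix.trace, diag_apply]
  rw [← Finset.sum_add_sum_compl S, Finset.sum_eq_zero (s := S)
    (fun i hi => sub_nystrom_apply_of_mem hA hdet hi i), zero_add, Finset.mul_sum]
  exact Finset.sum_congr rfl fun i hi =>
    det_mul_sub_nystrom_apply hA hdet (Finset.mem_compl.1 hi)

/-! ### Expected error under k-DPP sampling and the upper bound. -/

theorem expectedError_kDPP {N : ℕ} {A : Matrix (Fin N) (Fin N) ℝ} (hA : A.PosSemidef) {k : ℕ}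
    (hk : dppNormalizer A k ≠ 0) :
    expectedError A (kDPP hA k hk) =
      (∑ S ∈ (Finset.univ : Finset (Fin N)).powersetCard k,
        (principal A S).det * (A - nystrom A S).trace) / dppNormalizer A k := by
  have h : (Finset.univ : Finset (Fin N)).powersetCard k =
      (Finset.univ : Finset (Finset (Fin N))).filter (fun S => S.card = k) := by
    ext S; simp [Finset.mem_powersetCard]
  rw [expectedError, h, Finset.sum_filter, Finset.sum_div]
  refine Finset.sum_congr rfl fun S _ => ?_
  rw [kDPP, PMF.ofFintype_apply, ENNReal.toReal_ofReal (dppWeight_nonneg hA k S), dppWeight]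
  split_ifs
  · ring
  · simp

theorem sum_sum_det_insert {N : ℕ} (A : Matrix (Fin N) (Fin N) ℝ) (k : ℕ) :
    ∑ S ∈ (Finset.univ : Finset (Fin N)).powersetCard k,
        ∑ i ∈ Sᶜ, (principal A (insert i S)).det =
      ((k : ℝ) + 1) * dppNormalizer A (k + 1) := by
  rw [sum_powersetCard_insert k (fun _ T => (principal A T).det), dppNormalizer, Finset.mul_sum]
  refine Finset.sum_congr rfl fun T hT => ?_
  rw [Finset.sum_const, nsmul_eq_mul, (Finset.mem_powersetCard.1 hT).2, Nat.cast_succ]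

theorem dppNormalizer_pos {N : ℕ} {A : Matrix (Fin N) (Fin N) ℝ} (hA : A.PosSemidef) {k : ℕ}
    (hk : dppNormalizer A k ≠ 0) : 0 < dppNormalizer A k :=
  lt_of_le_of_ne (Finset.sum_nonneg fun S _ => det_principal_nonneg hA S) hk.symm

/-- Sets with vanishing minor add nothing on the left and a nonnegative amount on the right, so the
Schur identity is needed only for the others. -/
theorem expectedError_kDPP_le {N : ℕ} {A : Matrix (Fin N) (Fin N) ℝ} (hA : A.PosSemidef) {k : ℕ}
    (hk : dppNormalizer A k ≠ 0) :
    expectedError A (kDPP hA k hk) ≤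
      ((k : ℝ) + 1) * dppNormalizer A (k + 1) / dppNormalizer A k := by
  rw [expectedError_kDPP]
  refine div_le_div_of_nonneg_right ?_ (dppNormalizer_pos hA hk).le
  rw [← sum_sum_det_insert]
  refine Finset.sum_le_sum fun S _ => ?_
  by_cases h : (principal A S).det = 0
  · rw [h, zero_mul]
    exact Finset.sum_nonneg fun i _ => det_principal_nonneg hA _
  · exact (det_mul_trace_sub_nystrom hA.isHermitian h).le

/-- Positive diagonal entries make every minor nonzero; the resulting equality is what the lower
bound for k-DPP needs. -/
theorem expectedError_kDPP_diagonal {N : ℕ} {d : Fin N → ℝ} (hd : ∀ i, 0 < d i)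
    (hA : (diagonal d).PosSemidef) {k : ℕ} (hk : dppNormalizer (diagonal d) k ≠ 0) :
    expectedError (diagonal d) (kDPP hA k hk) =
      ((k : ℝ) + 1) * elemSymm d (k + 1) / elemSymm d k := by
  rw [expectedError_kDPP, ← dppNormalizer_diagonal, ← dppNormalizer_diagonal,
    ← sum_sum_det_insert]
  congr 1
  refine Finset.sum_congr rfl fun S _ => det_mul_trace_sub_nystrom hA.isHermitian ?_
  rw [det_principal_diagonal]
  exact (Finset.prod_pos fun i _ => hd i).ne'

theorem isApproximation_kDPP {N r k : ℕ} {ε : ℝ} (hε : 0 < ε) {A : Matrix (Fin N) (Fin N) ℝ}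
    (hA : A.PosSemidef) (hk : dppNormalizer A k ≠ 0)
    (h : (r : ℝ) / ε + r - 1 ≤ k) : IsApproximation hA r ε (kDPP hA k hk) := by
  refine (expectedError_kDPP_le hA hk).trans ?_
  rw [div_le_iff₀ (dppNormalizer_pos hA hk), trace_sub_lowRank,
    dppNormalizer_eq_elemSymm_eigenvalues hA.isHermitian,
    dppNormalizer_eq_elemSymm_eigenvalues hA.isHermitian]
  have h1 := sub_mul_elemSymm_succ_le hA.eigenvalues_nonneg (tailIndices N r)
    (card_tailIndices_compl_le N r) k
  have h2 : (k : ℝ) + 1 ≤ (1 + ε) * ((k : ℝ) + 1 - r) := by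
    have : (r : ℝ) / ε ≤ k + 1 - r := by linarith
    rw [div_le_iff₀ hε] at this
    linarith
  have h3 := elemSymm_nonneg hA.eigenvalues_nonneg (k + 1)
  calc _ ≤ (1 + ε) * (((k : ℝ) + 1 - r) * elemSymm hA.isHermitian.eigenvalues (k + 1)) := by
        rw [← mul_assoc]
        exact mul_le_mul_of_nonneg_right h2 h3
    _ ≤ _ := by
        rw [mul_assoc]
        exact mul_le_mul_of_nonneg_left h1 (by linarith)

/-! ### A diagonal matrix on which k-DPP sampling fails. -/

open Filter Topology

/-- `r` values `t` followed by `n` values `u`. -/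
def twoLevel (r n : ℕ) (t u : ℝ) (i : Fin (r + n)) : ℝ := if (i : ℕ) < r then t else u

theorem exists_kDPP_fails (r : ℕ) (ε : ℝ) (hε : 0 < ε) :
    ∃ (N : ℕ) (A : Matrix (Fin N) (Fin N) ℝ) (hA : A.PosSemidef),
      ∀ k : ℕ, (k : ℝ) < (r : ℝ) / ε + r - 1 →
        ∃ hk : dppNormalizer A k ≠ 0,
          expectedError A (kDPP hA k hk) > (1 + ε) * (A - lowRank hA.isHermitian r).trace := by
  -- In the limit this reads `(1 + ε) (k + 1 - r) < k + 1`, that is `k + 1 - r < r / ε`. Only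
  -- finitely many `k` occur, so one `n` serves them all.
  have hlim : ∀ᶠ n : ℕ in atTop, ∀ k ∈ Finset.range ⌈(r : ℝ) / ε + r - 1⌉₊,
      (1 + ε) * ((k : ℝ) + 1 - r + r * (n : ℝ)⁻¹) < (k + 1) * (1 - k * (n : ℝ)⁻¹) := by
    rw [Filter.eventually_all_finset]
    intro k hk
    have hk' : (k : ℝ) < (r : ℝ) / ε + r - 1 := Nat.lt_ceil.1 (Finset.mem_range.1 hk)
    have h0 : Tendsto (fun n : ℕ => (n : ℝ)⁻¹) atTop (𝓝 0) := tendsto_inv_atTop_nhds_zero_nat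
    refine Tendsto.eventually_lt
      ((((h0.const_mul (r : ℝ)).const_add ((k : ℝ) + 1 - r)).const_mul (1 + ε)))
      (((h0.const_mul (k : ℝ)).const_sub 1).const_mul ((k : ℝ) + 1)) ?_
    have : (k : ℝ) + 1 - r < r / ε := by linarith
    rw [lt_div_iff₀ hε] at this
    linarith
  obtain ⟨n, hn, hnK, hnε⟩ := (hlim.and ((eventually_ge_atTop
    (⌈(r : ℝ) / ε + r - 1⌉₊ + 1)).and (eventually_gt_atTop ⌈1 + ε⌉₊))).exists
  have hnpos : (0 : ℝ) < n := by exact_mod_cast (by omega : 0 < n)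
  have hnε' : 1 + ε < n := (Nat.le_ceil _).trans_lt (by exact_mod_cast hnε)
  set d := twoLevel r n n (n : ℝ)⁻¹ with hd
  have hdpos : ∀ i, 0 < d i := fun i => by
    simp only [hd, twoLevel]; split_ifs <;> positivity
  have hA : (diagonal d).PosSemidef := PosSemidef.diagonal fun i => (hdpos i).le
  set B : Finset (Fin (r + n)) := Finset.univ.filter fun i => (i : ℕ) < r with hBdef
  have hBcard : B.card = r := by
    rw [hBdef, Fin.card_filter_val_lt]; simp
  have hBc : Bᶜ.card = n := by
    rw [Finset.card_compl, hBcard, Fintype.card_fin, Nat.add_sub_cancel_left]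
  have hBt : ∀ i ∈ B, d i = n := fun i hi => if_pos (Finset.mem_filter.1 hi).2
  have hBu : ∀ i, i ∉ B → d i = (n : ℝ)⁻¹ := fun i hi => if_neg (by simpa [hBdef] using hi)
  have htrace : (diagonal d - lowRank hA.isHermitian r).trace ≤ 1 := by
    refine (trace_sub_lowRank_le hA.isHermitian (c := (n : ℝ)⁻¹) (by positivity) ?_).trans ?_
    · rw [smul_one_eq_diagonal, diagonal_sub, rank_diagonal, Fintype.card_subtype]
      refine (Finset.card_le_card fun i hi => ?_).trans hBcard.le
      by_contra h
      exact (Finset.mem_filter.1 hi).2 (sub_eq_zero.2 (hBu i h))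
    · rw [Nat.add_sub_cancel_left, mul_inv_cancel₀ hnpos.ne']
  refine ⟨r + n, diagonal d, hA, fun k hk => ?_⟩
  have hkK : k < ⌈(r : ℝ) / ε + r - 1⌉₊ := Nat.lt_ceil.2 hk
  have hEk : 0 < elemSymm d k := elemSymm_pos hdpos (by rw [Fintype.card_fin]; omega)
  have hEk1 : 0 < elemSymm d (k + 1) := elemSymm_pos hdpos (by rw [Fintype.card_fin]; omega)
  refine ⟨by rw [dppNormalizer_diagonal]; exact hEk.ne', ?_⟩
  rw [expectedError_kDPP_diagonal hdpos]
  refine lt_of_le_of_lt (mul_le_of_le_one_right (by linarith) htrace) ?_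
  rw [lt_div_iff₀ hEk]
  rcases lt_or_ge k r with hkr | hkr
  -- Fewer than `r` columns always miss an entry `n > 1 + ε`, while the optimum is at most one.
  · exact (mul_lt_mul_of_pos_right hnε' hEk).trans_le
      (mul_elemSymm_le_of_card_lt (fun i => (hdpos i).le) (fun i hi => (hBt i hi).ge)
        (hBcard.symm ▸ hkr))
  · have h1 := mul_elemSymm_le_of_le_succ hnpos (inv_nonneg.2 hnpos.le) hBt hBu hBcard
      (by rw [hBc, mul_inv_cancel₀ hnpos.ne']) (by omega : r ≤ k + 1)
    have h2 := hn k (Finset.mem_range.2 hkK)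
    rw [div_eq_mul_inv] at h1
    have hkr' : (r : ℝ) ≤ k := by exact_mod_cast hkr
    have hden : 0 < (k : ℝ) + 1 - r + r * (n : ℝ)⁻¹ := by
      have : 0 ≤ (r : ℝ) * (n : ℝ)⁻¹ := by positivity
      linarith
    refine lt_of_mul_lt_mul_left ?_ hden.le
    calc _ = (1 + ε) * ((k : ℝ) + 1 - r + r * (n : ℝ)⁻¹) * elemSymm d k := by ring
      _ < (k + 1) * (1 - k * (n : ℝ)⁻¹) * elemSymm d k := mul_lt_mul_of_pos_right h2 hEk
      _ ≤ (k + 1) * (((k : ℝ) + 1 - r + r * (n : ℝ)⁻¹) * elemSymm d (k + 1)) := by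
        rw [mul_assoc]
        exact mul_le_mul_of_nonneg_left h1 (by positivity)
      _ = _ := by ring

/-! ### A block matrix on which every small column set fails. -/

/-- The matrix with block `11ᵀ + δ I` on each fibre of `f`. -/
def onesBlocks {N r : ℕ} (f : Fin N → Fin r) (δ : ℝ) : Matrix (Fin N) (Fin N) ℝ :=
  (of fun (i : Fin N) (b : Fin r) => if f i = b then (1 : ℝ) else 0) *
    (of fun (i : Fin N) (b : Fin r) => if f i = b then (1 : ℝ) else 0)ᵀ + δ • 1

theorem posSemidef_onesBlocks {N r : ℕ} (f : Fin N → Fin r) {δ : ℝ} (hδ : 0 ≤ δ) :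
    (onesBlocks f δ).PosSemidef := by
  refine PosSemidef.add ?_ (PosSemidef.one.smul hδ)
  simpa using posSemidef_self_mul_conjTranspose
    (of fun (i : Fin N) (b : Fin r) => if f i = b then (1 : ℝ) else 0)

theorem rank_onesBlocks_sub_le {N r : ℕ} (f : Fin N → Fin r) (δ : ℝ) :
    (onesBlocks f δ - δ • 1).rank ≤ r := by
  rw [onesBlocks, add_sub_cancel_right]
  exact (rank_mul_le_left _ _).trans ((rank_le_card_width _).trans (Fintype.card_fin r).le)

theorem conj_onesBlocks_apply {N r : ℕ} (f : Fin N → Fin r) (δ : ℝ)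
    (Z : Matrix (Fin N) (Fin N) ℝ) (j : Fin N) :
    (Zᵀ * onesBlocks f δ * Z) j j =
      ∑ b, (∑ l with f l = b, Z l j) ^ 2 + δ * ∑ l, Z l j ^ 2 := by
  rw [onesBlocks]
  set P := (of fun (i : Fin N) (b : Fin r) => if f i = b then (1 : ℝ) else 0) with hP
  have h : Zᵀ * (P * Pᵀ + δ • 1) * Z = (Pᵀ * Z)ᵀ * (Pᵀ * Z) + δ • (Zᵀ * Z) := by
    simp [Matrix.mul_add, Matrix.add_mul, Matrix.mul_assoc, transpose_mul]
  rw [h, Matrix.add_apply, Matrix.smul_apply, Matrix.mul_apply, Matrix.mul_apply, smul_eq_mul]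
  congr 1
  · refine Finset.sum_congr rfl fun b _ => ?_
    rw [transpose_apply, ← sq, Matrix.mul_apply, Finset.sum_filter]
    simp [hP]
  · congr 1
    exact Finset.sum_congr rfl fun l _ => by rw [transpose_apply, sq]

/-- With `q ≥ u ^ 2 / s` the right side is a quadratic in `u` minimized at `u = -s / (s + δ)`;
clearing denominators leaves the square `((s + δ) u + s) ^ 2`. The case `s = 0` forces `u = 0`. -/
theorem ridge_lower_bound {δ u q : ℝ} {s : ℕ} (hδ : 0 < δ) (hq : 0 ≤ q)
    (h : u ^ 2 ≤ s * q) :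
    δ / (s + δ) ≤ (1 + u) ^ 2 + δ * q := by
  rcases Nat.eq_zero_or_pos s with rfl | hs
  · have hu : u = 0 := by
      rw [Nat.cast_zero, zero_mul] at h
      exact pow_eq_zero_iff two_ne_zero |>.1 (le_antisymm h (sq_nonneg u))
    rw [hu, Nat.cast_zero, zero_add, div_self hδ.ne', add_zero, one_pow]
    exact le_add_of_nonneg_right (mul_nonneg hδ.le hq)
  · have hs' : (0 : ℝ) < s := by exact_mod_cast hs
    rw [div_le_iff₀ (by positivity)]
    refine le_of_mul_le_mul_left ?_ hs'
    have h1 : δ * (s + δ) * u ^ 2 ≤ δ * (s + δ) * (s * q) :=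
      mul_le_mul_of_nonneg_left h (by positivity)
    linarith [sq_nonneg ((s + δ) * u + s)]

/-- Each unselected column of a block with `s` selected columns keeps error at least
`δ + δ / (s + δ)`. -/
theorem le_onesBlocks_sub_nystrom_apply {N r : ℕ} (f : Fin N → Fin r) {δ : ℝ} (hδ : 0 < δ)
    {S : Finset (Fin N)} {j : Fin N} (hj : j ∉ S) :
    δ + δ / ((S.filter fun l => f l = f j).card + δ) ≤
      (onesBlocks f δ - nystrom (onesBlocks f δ) S) j j := by
  rw [sub_nystrom_eq_conj (posSemidef_onesBlocks f hδ.le).isHermitian, conj_onesBlocks_apply]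
  set Z := residualMap (onesBlocks f δ) S
  set F := S.filter fun l => f l = f j
  -- Outside `S`, column `j` of the residual map is the basis vector at `j`; only the entries
  -- indexed by `S` are free, and the bound holds for any values of these.
  have hZ : ∀ l, l ∉ S → Z l j = (1 : Matrix (Fin N) (Fin N) ℝ) l j :=
    fun l hl => residualMap_apply_of_notMem _ hl j
  have hjF : j ∉ F := fun h => hj (Finset.mem_filter.1 h).1
  have hZj : Z j j = 1 := by rw [hZ j hj, one_apply_eq]
  have h1 : ∑ l with f l = f j, Z l j = 1 + ∑ l ∈ F, Z l j := by
    rw [← hZj, ← Finset.sum_insert (f := fun l => Z l j) hjF]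
    symm
    refine Finset.sum_subset (fun l hl => ?_) fun l hl hl' => ?_
    · rcases Finset.mem_insert.1 hl with rfl | hl
      · simp
      · simpa using (Finset.mem_filter.1 hl).2
    · rw [Finset.mem_insert, not_or] at hl'
      have : l ∉ S := fun h => hl'.2 (Finset.mem_filter.2 ⟨h, (Finset.mem_filter.1 hl).2⟩)
      rw [hZ l this, one_apply_ne hl'.1]
  have h2 : (1 + ∑ l ∈ F, Z l j) ^ 2 ≤ ∑ b, (∑ l with f l = b, Z l j) ^ 2 := by
    rw [← h1]
    exact Finset.single_le_sum (f := fun b => (∑ l with f l = b, Z l j) ^ 2)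
      (fun b _ => sq_nonneg _) (Finset.mem_univ (f j))
  have h3 : 1 + ∑ l ∈ F, Z l j ^ 2 ≤ ∑ l, Z l j ^ 2 := by
    have : (1 : ℝ) = Z j j ^ 2 := by rw [hZj, one_pow]
    rw [this, ← Finset.sum_insert (f := fun l => Z l j ^ 2) hjF]
    exact Finset.sum_le_sum_of_subset_of_nonneg (Finset.subset_univ _) fun _ _ _ => sq_nonneg _
  have h4 := ridge_lower_bound hδ
    (Finset.sum_nonneg fun l _ => sq_nonneg (Z l j)) (sq_sum_le_card_mul_sum_sq (s := F) (f := fun l => Z l j))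
  nlinarith

theorem onesBlocks_trace_bound {N r m : ℕ} (f : Fin N → Fin r) {δ : ℝ} (hδ : 0 < δ)
    (hf : ∀ b, (Finset.univ.filter fun l => f l = b).card = m)
    (S : Finset (Fin N)) (hS : S.card ≤ m) :
    ((m : ℝ) - S.card) * (δ * (r + r ^ 2 / (S.card + r * δ))) ≤
      (onesBlocks f δ - nystrom (onesBlocks f δ) S).trace := by
  set R := onesBlocks f δ - nystrom (onesBlocks f δ) S
  have hR : ∀ j, 0 ≤ R j j := fun j =>
    (posSemidef_sub_nystrom (posSemidef_onesBlocks f hδ.le) S).diag_nonneg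
  set s : Fin r → ℕ := fun b => (S.filter fun l => f l = b).card with hs
  have hsum : ∑ b, (s b : ℝ) = S.card := by
    rw [Finset.card_eq_sum_card_fiberwise (f := f) (t := Finset.univ) (by simp)]
    push_cast
    rfl
  have h1 : ∀ b, ((m : ℝ) - S.card) * (δ + δ / (s b + δ)) ≤ ∑ l with f l = b, R l l := by
    intro b
    set G := (Finset.univ.filter fun l => f l = b) \ S with hG
    -- Charging all of `S` to every block is crude, but costs only a factor `1 - k / m`, which tends
    -- to one.
    have hGc : (m : ℝ) - S.card ≤ G.card := by
      have := Finset.le_card_sdiff S (Finset.univ.filter fun l => f l = b)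
      rw [hf b, tsub_le_iff_right] at this
      have : (m : ℝ) ≤ G.card + S.card := by exact_mod_cast this
      linarith
    calc _ ≤ (G.card : ℝ) * (δ + δ / (s b + δ)) :=
          mul_le_mul_of_nonneg_right hGc (by positivity)
      _ = ∑ l ∈ G, (δ + δ / (s b + δ)) := by rw [Finset.sum_const, nsmul_eq_mul]
      _ ≤ ∑ l ∈ G, R l l := by
        refine Finset.sum_le_sum fun l hl => ?_
        rw [hG, Finset.mem_sdiff, Finset.mem_filter] at hl
        have := le_onesBlocks_sub_nystrom_apply f hδ hl.2
        rwa [hl.1.2] at this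
      _ ≤ _ := Finset.sum_le_sum_of_subset_of_nonneg Finset.sdiff_subset fun l _ _ => hR l
  -- Cauchy–Schwarz with unit numerators.
  have h2 : (r : ℝ) ^ 2 / (S.card + r * δ) ≤ ∑ b : Fin r, 1 / ((s b : ℝ) + δ) := by
    have := Finset.sq_sum_div_le_sum_sq_div (Finset.univ : Finset (Fin r)) (fun _ => (1 : ℝ))
      (g := fun b => (s b : ℝ) + δ) (fun b _ => by positivity)
    simpa [Finset.sum_add_distrib, hsum] using this
  calc _ ≤ ((m : ℝ) - S.card) * (δ * (r + ∑ b : Fin r, 1 / ((s b : ℝ) + δ))) := by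
        refine mul_le_mul_of_nonneg_left ?_ (sub_nonneg.2 (by exact_mod_cast hS))
        exact mul_le_mul_of_nonneg_left (by linarith) hδ.le
    _ = ∑ b, ((m : ℝ) - S.card) * (δ + δ / (s b + δ)) := by
        rw [← Finset.mul_sum, Finset.sum_add_distrib]
        simp [mul_add, Finset.mul_sum, mul_comm, div_eq_mul_inv]
    _ ≤ ∑ b, ∑ l with f l = b, R l l := Finset.sum_le_sum fun b _ => h1 b
    _ = R.trace := by
        rw [Finset.sum_fiberwise]
        rfl

theorem exists_forall_columns_fail (r : ℕ) (hr : 1 ≤ r) (ε : ℝ) (hε : 0 < ε) :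
    ∃ (N : ℕ) (A : Matrix (Fin N) (Fin N) ℝ) (hA : A.PosSemidef),
      ∀ k : ℕ, (k : ℝ) < (r : ℝ) / ε → ∀ S : Finset (Fin N), S.card = k →
        (A - nystrom A S).trace > (1 + ε) * (A - lowRank hA.isHermitian r).trace := by
  have hr' : (0 : ℝ) < r := by exact_mod_cast hr
  -- The limit is `(1 + ε) k < k + r`, that is `k < r / ε`. The denominator `k + r / m` is cleared
  -- beforehand because its limit vanishes at `k = 0`.
  have hlim : ∀ᶠ m : ℕ in atTop, ∀ k ∈ Finset.range ⌈(r : ℝ) / ε⌉₊,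
      (1 + ε) * ((k : ℝ) + r * (m : ℝ)⁻¹) <
        (1 - k * (m : ℝ)⁻¹) * ((k : ℝ) + r * (m : ℝ)⁻¹ + r) := by
    rw [Filter.eventually_all_finset]
    intro k hk
    have hk' : (k : ℝ) < (r : ℝ) / ε := Nat.lt_ceil.1 (Finset.mem_range.1 hk)
    have h0 : Tendsto (fun n : ℕ => (n : ℝ)⁻¹) atTop (𝓝 0) := tendsto_inv_atTop_nhds_zero_nat
    have h1 := (h0.const_mul (r : ℝ)).const_add (k : ℝ)
    refine Tendsto.eventually_lt (h1.const_mul (1 + ε))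
      (((h0.const_mul (k : ℝ)).const_sub 1).mul (h1.add_const (r : ℝ))) ?_
    rw [lt_div_iff₀ hε] at hk'
    linarith
  obtain ⟨m, hm, hmK⟩ := (hlim.and (eventually_ge_atTop (⌈(r : ℝ) / ε⌉₊ + 1))).exists
  have hmpos : (0 : ℝ) < m := by exact_mod_cast (by omega : 0 < m)
  let f : Fin (r * m) → Fin r := fun l => (finProdFinEquiv.symm l).1
  have hf : ∀ b, (Finset.univ.filter fun l => f l = b).card = m := by
    intro b
    refine Eq.trans ?_ (Finset.card_fin m)
    refine Finset.card_nbij' (fun l => (finProdFinEquiv.symm l).2)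
      (fun j => finProdFinEquiv (b, j)) ?_ ?_ ?_ ?_
    · intro l _
      exact Finset.mem_coe.2 (Finset.mem_univ _)
    · intro j _
      exact Finset.mem_coe.2 (Finset.mem_filter.2 ⟨Finset.mem_univ _,
        congrArg Prod.fst (finProdFinEquiv.symm_apply_apply (b, j))⟩)
    · intro l hl
      have hl' : (finProdFinEquiv.symm l).1 = b := (Finset.mem_filter.1 (Finset.mem_coe.1 hl)).2
      subst hl'
      exact finProdFinEquiv.apply_symm_apply l
    · intro j _
      exact congrArg Prod.snd (finProdFinEquiv.symm_apply_apply (b, j))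
  refine ⟨r * m, onesBlocks f (m : ℝ)⁻¹, posSemidef_onesBlocks f (by positivity),
    fun k hk S hS => ?_⟩
  have hkK : k < ⌈(r : ℝ) / ε⌉₊ := Nat.lt_ceil.2 hk
  have hlow := onesBlocks_trace_bound f (inv_pos.2 hmpos) hf S (by omega)
  have hup := trace_sub_lowRank_le
    (posSemidef_onesBlocks f (inv_nonneg.2 hmpos.le)).isHermitian (inv_nonneg.2 hmpos.le)
    (rank_onesBlocks_sub_le f (m : ℝ)⁻¹)
  rw [hS] at hlow
  have hNr : ((r * m - r : ℕ) : ℝ) * (m : ℝ)⁻¹ ≤ r := by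
    rw [← div_eq_mul_inv, div_le_iff₀ hmpos]
    exact_mod_cast Nat.sub_le _ _
  refine lt_of_le_of_lt (mul_le_mul_of_nonneg_left (hup.trans hNr) (by linarith))
    (lt_of_lt_of_le ?_ hlow)
  have h1 := hm k (Finset.mem_range.2 hkK)
  have hden : 0 < (k : ℝ) + r * (m : ℝ)⁻¹ := by positivity
  have h2 : ((m : ℝ) - k) * ((m : ℝ)⁻¹ * (r + r ^ 2 / (k + r * (m : ℝ)⁻¹))) =
      r * ((1 - k * (m : ℝ)⁻¹) * ((k : ℝ) + r * (m : ℝ)⁻¹ + r)) / (k + r * (m : ℝ)⁻¹) := by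
    have h3 : ((m : ℝ) - k) * (m : ℝ)⁻¹ = 1 - k * (m : ℝ)⁻¹ := by
      rw [sub_mul, mul_inv_cancel₀ hmpos.ne']
    rw [← mul_assoc, h3]
    field_simp
  rw [h2, lt_div_iff₀ hden]
  nlinarith

end Nystrom

end

theorem theorem4p3 (r : ℕ) (hr : 1 ≤ r) (ε : ℝ) (hε : 0 < ε) :
    -- upper bound for k-DPP sampling, for every psd matrix
    (∀ (N : ℕ) (A : Matrix (Fin N) (Fin N) ℝ) (hA : A.PosSemidef) (k : ℕ)
      (hk : Nystrom.dppNormalizer A k ≠ 0),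
      (r : ℝ) / ε + r - 1 ≤ k →
        Nystrom.IsApproximation hA r ε (Nystrom.kDPP hA k hk)) ∧
    -- one psd matrix on which k-DPP sampling is well defined and fails for all smaller k
    (∃ (N : ℕ) (A : Matrix (Fin N) (Fin N) ℝ) (hA : A.PosSemidef),
      ∀ k : ℕ, (k : ℝ) < (r : ℝ) / ε + r - 1 →
        ∃ hk : Nystrom.dppNormalizer A k ≠ 0,
          Nystrom.expectedError A (Nystrom.kDPP hA k hk) >
            (1 + ε) * (A - Nystrom.lowRank hA.isHermitian r).trace) ∧
    -- one psd matrix on which every choice of k columns fails, for all k < r / ε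
    (∃ (N : ℕ) (A : Matrix (Fin N) (Fin N) ℝ) (hA : A.PosSemidef),
      ∀ k : ℕ, (k : ℝ) < (r : ℝ) / ε →
        ∀ S : Finset (Fin N), S.card = k →
          (A - Nystrom.nystrom A S).trace >
            (1 + ε) * (A - Nystrom.lowRank hA.isHermitian r).trace) := by
  exact ⟨fun _ _ hA _ hk h => Nystrom.isApproximation_kDPP hε hA hk h,
    Nystrom.exists_kDPP_fails r ε hε, Nystrom.exists_forall_columns_fail r hr ε hε⟩
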